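/- Let $d\ge 1$ be an integer; all graphs are finite and simple. A $d$-dimensional realization of a graph $G=(V,E)$ is a map $p:V\to\mathbb{R}^d$; it is generic if its $d|V|$ coordinates are algebraically independent over $\mathbb{Q}$. Realizations $p,q$ of $G$ are equivalent if $\|p(u)-p(v)\|=\|q(u)-q(v)\|$ for all $uv\in E$, and congruent if this holds for all $u,v\in V$. The framework $(G,p)$ is rigid if there is $\varepsilon>0$ such that every $q$ equivalent to $p$ with $\|p(v)-q(v)\|<\varepsilon$ for all $v\in V$ is congruent to $p$; the graph $G$ is rigid in $\mathbb{R}^d$ if $(G,p)$ is rigid for every generic realization $p$ of $G$ in $\mathbb{R}^d$. The graph $G$ is totally loose in $\mathbb{R}^d$ if for every pair of distinct non-adjacent vertices $u,v$ and every generic realization $p$ of $G$ in $\mathbb{R}^d$ there is a realization $q$ equivalent to $p$ with $\|q(u)-q(v)\|\ne\|p(u)-p(v)\|$. The graph $G$ is $d$-special if it is rigid in $\mathbb{R}^d$ and every proper induced subgraph of $G$ that is rigid in $\mathbb{R}^d$ is complete. A clique sum of graphs $G_1,G_2$ is a graph obtained from disjoint copies of $G_1$ and $G_2$ by choosing, for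 some $t\ge 1$, complete subgraphs $K_i$ of $G_i$ on $t$ vertices ($i=1,2$) and identifying the vertices of $K_1$ with the vertices of $K_2$ along some bijection. Theorem. Every graph that is rigid and totally loose in $\mathbb{R}^d$ can be obtained from $d$-special graphs by a (possibly empty) sequence of clique sum operations; that is, it belongs, up to isomorphism, to the smallest class of graphs that contains all $d$-special graphs and is closed under clique sums. -/

import Mathlib

universe u

namespace GraphRigidity

/-- A `d`-dimensional realization (framework) of a graph on the vertex set `V`: a map placing
every vertex in Euclidean `d`-space. -/
abbrev Realization (d : ℕ) (V : Type*) : Type _ := V → EuclideanSpace ℝ (Fin d)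

/-- The `d|V|` vertex coordinates are algebraically independent over `ℚ`. -/
def IsGeneric {d : ℕ} {V : Type*} (p : Realization d V) : Prop :=
  AlgebraicIndependent ℚ (fun x : V × Fin d => p x.1 x.2)

/-- `(G,p)` and `(G,q)` are equivalent: corresponding edge lengths are the same. -/
def Equivalent {d : ℕ} {V : Type*} (G : SimpleGraph V) (p q : Realization d V) : Prop :=
  ∀ u v : V, G.Adj u v → ‖p u - p v‖ = ‖q u - q v‖

/-- `(G,p)` and `(G,q)` are congruent: all pairwise vertex distances are the same. -/
def Congruent {d : ℕ} {V : Type*} (p q : Realization d V) : Prop :=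
  ∀ u v : V, ‖p u - p v‖ = ‖q u - q v‖

/-- The framework `(G,p)` is rigid. -/
def IsRigidFramework {d : ℕ} {V : Type*} (G : SimpleGraph V) (p : Realization d V) : Prop :=
  ∃ ε : ℝ, 0 < ε ∧ ∀ q : Realization d V,
    Equivalent G q p → (∀ v : V, ‖p v - q v‖ < ε) → Congruent q p

/-- The graph `G` is rigid in `ℝ^d`: every generic realization of it is rigid. -/
def IsRigid (d : ℕ) {V : Type*} (G : SimpleGraph V) : Prop :=
  ∀ p : Realization d V, IsGeneric p → IsRigidFramework G p

/-- The pair `{u, v}` is globally linked in the framework `(G,p)`. -/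
def GloballyLinkedIn {d : ℕ} {V : Type*} (G : SimpleGraph V) (p : Realization d V)
    (u v : V) : Prop :=
  ∀ q : Realization d V, Equivalent G q p → ‖p u - p v‖ = ‖q u - q v‖

/-- The pair `{u, v}` is weakly globally linked in `G` in `ℝ^d`: it is globally linked in some
generic realization. -/
def WeaklyGloballyLinked (d : ℕ) {V : Type*} (G : SimpleGraph V) (u v : V) : Prop :=
  ∃ p : Realization d V, IsGeneric p ∧ GloballyLinkedIn G p u v

/-- The pair `{u, v}` is globally loose in `G` in `ℝ^d`. -/
def GloballyLoose (d : ℕ) {V : Type*} (G : SimpleGraph V) (u v : V) : Prop :=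
  ¬ WeaklyGloballyLinked d G u v

/-- `G` is totally loose in `ℝ^d`: every non-adjacent pair of distinct vertices is globally
loose. -/
def IsTotallyLoose (d : ℕ) {V : Type*} (G : SimpleGraph V) : Prop :=
  ∀ u v : V, u ≠ v → ¬ G.Adj u v → GloballyLoose d G u v

/-- `G` is `d`-special: it is rigid in `ℝ^d`, and every rigid proper induced subgraph of it is
complete. -/
def IsSpecial (d : ℕ) {V : Type*} (G : SimpleGraph V) : Prop :=
  IsRigid d G ∧ ∀ X : Set V, X ≠ Set.univ → IsRigid d (G.induce X) → G.induce X = ⊤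

/-- `G` is (up to renaming of vertices) the graph obtained from `G₁` and `G₂` by a `t`-clique sum
operation: there are cliques `K₁`, `K₂` on `t` vertices and a bijection `φ` between them, such that
`G` arises by identifying each `x ∈ K₁` with `φ x ∈ K₂` and nothing else. The maps `f₁`, `f₂` send
the vertices of the two graphs to their places in `G`. -/
def IsCliqueSum (t : ℕ) {V₁ V₂ V : Type*} (G₁ : SimpleGraph V₁) (G₂ : SimpleGraph V₂)
    (G : SimpleGraph V) : Prop :=
  ∃ (K₁ : Finset V₁) (K₂ : Finset V₂) (φ : K₁ ≃ K₂) (f₁ : V₁ ↪ V) (f₂ : V₂ ↪ V),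
    G₁.IsNClique t K₁ ∧ G₂.IsNClique t K₂ ∧
    (∀ (x : V₁) (y : V₂), f₁ x = f₂ y ↔ ∃ hx : x ∈ K₁, (φ ⟨x, hx⟩ : V₂) = y) ∧
    Set.range f₁ ∪ Set.range f₂ = Set.univ ∧
    G = G₁.map f₁ ⊔ G₂.map f₂

/-- The finite graphs that can be obtained from `d`-special graphs by a (possibly empty) sequence
of clique sum operations. -/
inductive ObtainedFromSpecial (d : ℕ) : {V : Type u} → SimpleGraph V → Prop
  | special {V : Type u} [Finite V] (G : SimpleGraph V) (hG : IsSpecial d G) :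
      ObtainedFromSpecial d G
  | cliqueSum {V₁ V₂ V : Type u} (G₁ : SimpleGraph V₁) (G₂ : SimpleGraph V₂) (G : SimpleGraph V)
      (t : ℕ) (ht : 1 ≤ t) (h₁ : ObtainedFromSpecial d G₁) (h₂ : ObtainedFromSpecial d G₂)
      (hG : IsCliqueSum t G₁ G₂ G) : ObtainedFromSpecial d G

end GraphRigidity

/-!
The theorem is proved by induction on the number of vertices. If the rigid, totally loose graph `G`
is not `d`-special, it has a proper vertex set `X` such that `G[X]` is rigid and not complete. Let
`C` be a connected component of `G - X` and `N(C)` its set of neighbours, which lies in `X`. Two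
nonadjacent vertices of `N(C)` would be weakly globally linked
(`weaklyGloballyLinked_of_outer_path`), contradicting total looseness, so `N(C)` is a clique, and
`G` is the clique sum of `G[V \ C]` and `G[C ∪ N(C)]` along `N(C)`, which is nonempty because rigid
graphs are connected (`IsRigid.preconnected`). Both parts are smaller than `G`, since `C` is nonempty
and `X` is not a clique, and both are again rigid (`IsRigid.induce_of_clique_separator`) and
totally loose (`IsTotallyLoose.induce`).

The heart of the matter is that `u, v ∈ X` are weakly globally linked if `G[X]` is rigid and `u`,
`v` are joined by a path outside `X`. Collapsing the path onto `u` bounds the distance of `u` and `v`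
in every equivalent realization by essentially their present distance. It therefore suffices to
place `X` near a realization `x` at which the distance is minimal among the realizations of `G[X]`
equivalent to `x`, provided that this minimality persists under perturbation and that slightly
larger distances are excluded as well (`IsRigid.exists_stable_minimum`). For this no genericity of
`x` is needed:

* Rigidity makes the squared distance `g` of `u` and `v` algebraic over the squared edge lengths `f`
  at a generic realization `p` (`IsRigid.isAlgebraic_sqDist`). Otherwise a transcendence basis of
  `ℚ(f(p))`, together with `g(p)`, could be completed by coordinates to a transcendence basis of
  `ℚ(p)`; a polynomial map through such a basis is open at `p`
  (`map_nhds_eq_of_transcendenceBasis`), so `g` could be changed while `f` is kept.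
* Hence there is a polynomial `P` over `ℚ` with `P(f, g) = 0` identically such that `P(f(p), T)` is
  separable. If `x` minimizes `g` among the realizations equivalent to `p`, then `f(x) = f(p)`, so
  `g(x)` is a simple root of `P(f(x), T)`. By compactness, realizations near `x` that violate the
  claim would yield two distinct roots of `P(f(y), T)` converging to this simple root as `y → x`,
  which is impossible by Rolle's theorem.
-/

namespace GraphRigidity

open Filter Topology

/-! ### Algebraically independent points -/

/-- Points with algebraically independent coordinates are dense, even with part of the coordinates
prescribed: the coordinates are moved one at a time, avoiding countably many algebraic values. -/
theorem exists_algebraicIndependent_near {σ : Type*} [Finite σ] (A : Set σ) (p : σ → ℝ)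
    (hA : AlgebraicIndepOn ℚ p A) {ε : ℝ} (hε : 0 < ε) :
    ∃ p' : σ → ℝ, (∀ x ∈ A, p' x = p x) ∧ (∀ x, |p' x - p x| < ε) ∧
      AlgebraicIndependent ℚ p' := by
  classical
  have step : ∀ B : Set σ, B.Finite → ∃ p' : σ → ℝ, (∀ x ∈ A, p' x = p x) ∧
      (∀ x, |p' x - p x| < ε) ∧ AlgebraicIndepOn ℚ p' (A ∪ B) := by
    intro B hB
    induction B, hB using Set.Finite.induction_on with
    | empty => exact ⟨p, fun _ _ => rfl, by simp [hε], by simpa using hA⟩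
    | @insert a B haB hB ih =>
      obtain ⟨p', h1, h2, h3⟩ := ih
      by_cases ha : a ∈ A ∪ B
      · refine ⟨p', h1, h2, ?_⟩
        rwa [Set.union_insert, Set.insert_eq_of_mem ha]
      · have hc : Set.Countable {t : ℝ | IsAlgebraic (Algebra.adjoin ℚ (p' '' (A ∪ B))) t} := by
          have : Countable (Algebra.adjoin ℚ (p' '' (A ∪ B))) := by
            rw [← Cardinal.mk_le_aleph0_iff]
            refine (Algebra.cardinalMk_adjoin_le ℚ _).trans ?_
            simp
          exact Algebraic.countable _ _
        have hu : ¬ (Set.Ioo (p a - ε) (p a + ε)).Countable := by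
          rw [← Cardinal.le_aleph0_iff_set_countable, Cardinal.mk_Ioo_real (by linarith)]
          exact not_le.2 Cardinal.aleph0_lt_continuum
        obtain ⟨t, ht, htr⟩ : ∃ t ∈ Set.Ioo (p a - ε) (p a + ε),
            Transcendental (Algebra.adjoin ℚ (p' '' (A ∪ B))) t := by
          by_contra! hcon
          exact hu (hc.mono fun t ht => by simpa [Transcendental] using hcon t ht)
        have heq : Set.EqOn (Function.update p' a t) p' (A ∪ B) := fun x hx =>
          Function.update_of_ne (fun h : x = a => ha (by rwa [h] at hx)) _ _
        refine ⟨Function.update p' a t, fun x hx => ?_, fun x => ?_, ?_⟩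
        · rw [heq (Or.inl hx), h1 x hx]
        · by_cases hx : x = a
          · subst hx
            simp only [Function.update_self, abs_lt]
            constructor <;> linarith [ht.1, ht.2]
          · rw [Function.update_of_ne hx]
            exact h2 x
        · rw [Set.union_insert]
          apply AlgebraicIndepOn.insert
          · have : (fun x : (A ∪ B : Set σ) => Function.update p' a t x) =
                fun x : (A ∪ B : Set σ) => p' x := funext fun x => heq x.2
            unfold AlgebraicIndepOn
            rw [this]
            exact h3
          · rw [Set.image_congr heq, Function.update_self]
            exact htr
  obtain ⟨p', h1, h2, h3⟩ := step Set.univ Set.finite_univ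
  refine ⟨p', h1, h2, ?_⟩
  rw [Set.union_univ] at h3
  exact h3.comp (fun x => ⟨x, trivial⟩) fun x y h => congrArg Subtype.val h

/-! ### Separable relations -/

/-- The real polynomial obtained from `P ∈ ℚ[Y][T]` by substituting the real numbers `w` for the
variables `Y`. -/
noncomputable def specialize {ι : Type*} (P : Polynomial (MvPolynomial ι ℚ)) (w : ι → ℝ) :
    Polynomial ℝ :=
  P.map (MvPolynomial.aeval w : MvPolynomial ι ℚ →ₐ[ℚ] ℝ).toRingHom

/-- A real number algebraic over `ℚ[w]` is a root of a separable polynomial that comes from a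
polynomial over `ℚ[Y]`, namely its minimal polynomial over `ℚ(w)` with denominators cleared. -/
theorem exists_separable_relation {ι : Type*} (w : ι → ℝ) (z : ℝ)
    (hz : IsAlgebraic (Algebra.adjoin ℚ (Set.range w)) z) :
    ∃ P : Polynomial (MvPolynomial ι ℚ), (specialize P w).eval z = 0 ∧
      (specialize P w).Separable := by
  let A := Algebra.adjoin ℚ (Set.range w)
  let K := IntermediateField.adjoin ℚ (Set.range w)
  open scoped IntermediateField.algebraAdjoinAdjoin in
  have hK : IsIntegral K z := by
    rw [← isAlgebraic_iff_isIntegral]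
    exact (IsFractionRing.isAlgebraic_iff A K ℝ).1 hz
  open scoped IntermediateField.algebraAdjoinAdjoin in
  obtain ⟨b, hb, hP⟩ := IsLocalization.integerNormalization_spec (nonZeroDivisors A) (minpoly K z)
  let φ : MvPolynomial ι ℚ →ₐ[ℚ] A := (MvPolynomial.aeval w).codRestrict A fun x => by
    rw [show A = _ from Algebra.adjoin_range_eq_range_aeval ℚ w]
    exact ⟨x, rfl⟩
  have hφ : Function.Surjective φ.toRingHom := by
    rintro ⟨a, ha⟩
    have ha' := ha
    rw [show A = _ from Algebra.adjoin_range_eq_range_aeval ℚ w] at ha'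
    obtain ⟨x, hx⟩ := ha'
    exact ⟨x, Subtype.ext hx⟩
  obtain ⟨P, hPQ⟩ := Polynomial.map_surjective _ hφ
    (IsLocalization.integerNormalization (nonZeroDivisors A) (minpoly K z))
  have hb0 : (b : ℝ) ≠ 0 := by
    have := nonZeroDivisors.ne_zero hb
    simpa using this
  have key : specialize P w =
      Polynomial.C (b : ℝ) * (minpoly K z).map (algebraMap K ℝ) := by
    have h1 : specialize P w = (P.map φ.toRingHom).map (algebraMap A ℝ) := by
      rw [Polynomial.map_map]
      rfl
    have h2 : algebraMap A ℝ = (algebraMap K ℝ).comp (algebraMap A K) := rfl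
    rw [h1, hPQ, h2, ← Polynomial.map_map, hP, Algebra.smul_def, Polynomial.map_mul]
    congr 1
    simp [Polynomial.algebraMap_apply]
    rfl
  refine ⟨P, ?_, ?_⟩
  · rw [key, Polynomial.eval_mul, Polynomial.eval_map_algebraMap, minpoly.aeval, mul_zero]
  · rw [key]
    refine ((minpoly.irreducible hK).separable.map (f := algebraMap K ℝ)).of_dvd ?_
    exact ((Polynomial.isUnit_C.2 hb0.isUnit).mul_left_dvd).2 dvd_rfl

/-- A polynomial relation that holds at a generic point holds identically. -/
theorem specialize_eval_eq_zero {σ ι : Type*} {p : σ → ℝ} (hp : AlgebraicIndependent ℚ p)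
    (y : ι → MvPolynomial σ ℚ) (z : MvPolynomial σ ℚ) (P : Polynomial (MvPolynomial ι ℚ))
    (hP : (specialize P fun i => MvPolynomial.aeval p (y i)).eval (MvPolynomial.aeval p z) = 0)
    (q : σ → ℝ) :
    (specialize P fun i => MvPolynomial.aeval q (y i)).eval (MvPolynomial.aeval q z) = 0 := by
  have key : ∀ q : σ → ℝ,
      (specialize P fun i => MvPolynomial.aeval q (y i)).eval (MvPolynomial.aeval q z) =
      MvPolynomial.aeval q (P.eval₂ (MvPolynomial.aeval y).toRingHom z) := by
    intro q
    have := Polynomial.hom_eval₂ P (MvPolynomial.aeval y).toRingHom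
      (MvPolynomial.aeval q : MvPolynomial σ ℚ →ₐ[ℚ] ℝ).toRingHom z
    refine Eq.trans ?_ this.symm
    rw [specialize, Polynomial.eval_map]
    congr 1
    ext x
    · simp
    · simp
  rw [key] at hP ⊢
  rw [(algebraicIndependent_iff.1 hp) _ hP, map_zero]

/-! ### Polynomial maps near an algebraically independent point -/

theorem contDiff_aeval {σ : Type*} [Fintype σ] (c : MvPolynomial σ ℚ) :
    ContDiff ℝ 1 fun q : σ → ℝ => MvPolynomial.aeval q c := by
  induction c using MvPolynomial.induction_on with
  | C a => simpa using contDiff_const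
  | add a b ha hb => simpa using ha.add hb
  | mul_X a i ha => simpa using ha.mul (contDiff_apply ℝ ℝ i)

theorem continuous_aeval {σ : Type*} (c : MvPolynomial σ ℚ) :
    Continuous fun q : σ → ℝ => MvPolynomial.aeval q c := by
  induction c using MvPolynomial.induction_on with
  | C a => simpa using continuous_const
  | add a b ha hb => simpa [Pi.add_def] using ha.add hb
  | mul_X a i ha => simpa [Pi.mul_def] using ha.mul (continuous_apply i)

theorem hasDerivAt_aeval_zero {ι : Type*} (c : MvPolynomial ι ℚ) {w : ℝ → ι → ℝ} {t : ℝ}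
    (hw : ∀ i, HasDerivAt (fun s => w s i) 0 t) :
    HasDerivAt (fun s => MvPolynomial.aeval (w s) c) 0 t := by
  induction c using MvPolynomial.induction_on with
  | C a => simpa using hasDerivAt_const t (a : ℝ)
  | add a b ha hb => simpa [Pi.add_def] using ha.add hb
  | mul_X a i ha => simpa [Pi.mul_def] using ha.mul (hw i)

/-- If the parameters `w` are stationary at `t`, then differentiating `P(w(s), x(s))` at `t` only
sees the variation of the last variable `x`. -/
theorem hasDerivAt_specialize_eval {ι : Type*} (P : Polynomial (MvPolynomial ι ℚ))
    {w : ℝ → ι → ℝ} {x : ℝ → ℝ} {x' t : ℝ}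
    (hw : ∀ i, HasDerivAt (fun s => w s i) 0 t) (hx : HasDerivAt x x' t) :
    HasDerivAt (fun s => (specialize P (w s)).eval (x s))
      ((specialize P (w t)).derivative.eval (x t) * x') t := by
  induction P using Polynomial.induction_on' with
  | add P Q hP hQ =>
    simp only [specialize, Polynomial.map_add, Polynomial.eval_add, Polynomial.derivative_add,
      add_mul] at hP hQ ⊢
    exact hP.add hQ
  | monomial n a =>
    have h := (hasDerivAt_aeval_zero a hw).mul (hx.pow n)
    simp only [specialize, Polynomial.map_monomial, Polynomial.eval_monomial,
      Polynomial.derivative_monomial]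
    refine h.congr_deriv ?_
    simp
    ring

/-- A polynomial map whose value at the generic point `p` is a transcendence basis of `ℚ(p)` is
open at `p`: the coordinates are simple roots of polynomials over the values of the map, so its
derivative is injective, and it is bijective because there are at most as many values as
coordinates. -/
theorem map_nhds_eq_of_transcendenceBasis {σ τ : Type*} [Finite σ] [Finite τ] {p : σ → ℝ}
    (hp : AlgebraicIndependent ℚ p) (h : τ → MvPolynomial σ ℚ)
    (hind : AlgebraicIndependent ℚ fun i => MvPolynomial.aeval p (h i))
    (halg : ∀ x, IsAlgebraic
      (Algebra.adjoin ℚ (Set.range fun i => MvPolynomial.aeval p (h i))) (p x)) :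
    map (fun (q : σ → ℝ) i => (MvPolynomial.aeval q (h i) : ℝ)) (𝓝 p) =
      𝓝 fun i => MvPolynomial.aeval p (h i) := by
  classical
  have := Fintype.ofFinite σ
  have := Fintype.ofFinite τ
  let F : (σ → ℝ) → τ → ℝ := fun q i => MvPolynomial.aeval q (h i)
  have hF : ContDiff ℝ 1 F := contDiff_pi.2 fun i => contDiff_aeval (h i)
  have hd : HasStrictFDerivAt F (fderiv ℝ F p) p :=
    hF.contDiffAt.hasStrictFDerivAt one_ne_zero
  have hinj : Function.Injective (fderiv ℝ F p) := by
    rw [injective_iff_map_eq_zero]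
    intro v hv
    -- the line through `p` in the direction `v`
    have hline : ∀ x, HasDerivAt (fun s : ℝ => (p + s • v) x) (v x) 0 := fun x => by
      simpa using ((hasDerivAt_id (0 : ℝ)).mul_const (v x)).const_add (p x)
    have hline' : HasDerivAt (fun s : ℝ => p + s • v) v 0 := hasDerivAt_pi.2 hline
    have hFline : HasDerivAt (fun s : ℝ => F (p + s • v)) 0 0 := by
      have := HasFDerivAt.comp_hasDerivAt (l := F) (l' := fderiv ℝ F p) (0 : ℝ)
        (by simpa using hd.hasFDerivAt) hline'
      rwa [hv] at this
    -- differentiating the relation of the coordinate `x` along the line gives `v x = 0`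
    funext x
    obtain ⟨P, hP0, hPsep⟩ := exists_separable_relation _ _ (halg x)
    have hzero := specialize_eval_eq_zero hp h (MvPolynomial.X x) P (by simpa using hP0)
    have hder := hasDerivAt_specialize_eval P (fun i => (hasDerivAt_pi.1 hFline) i) (hline x)
    have h0 : (fun s : ℝ => (specialize P (F (p + s • v))).eval ((p + s • v) x)) =
        fun _ => 0 := funext fun s => by simpa using hzero (p + s • v)
    rw [h0] at hder
    have h1 := hder.unique (hasDerivAt_const 0 0)
    have h2 : (specialize P (F p)).derivative.eval (p x) ≠ 0 := by
      have := hPsep.eval₂_derivative_ne_zero (RingHom.id ℝ) (x := p x) (by simpa using hP0)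
      simpa using this
    simpa [h2] using h1
  -- `h` consists of algebraically independent polynomials
  have hcard : Fintype.card τ ≤ Fintype.card σ := by
    have h1 : AlgebraicIndependent ℚ h :=
      AlgebraicIndependent.of_comp (MvPolynomial.aeval p) hind
    have h2 := h1.lift_cardinalMk_le_trdeg
    rw [MvPolynomial.trdeg_of_isDomain] at h2
    simpa using h2
  have hsurj : (fderiv ℝ F p).range = ⊤ := by
    have hle : Fintype.card σ ≤ Fintype.card τ := by
      simpa using LinearMap.finrank_le_finrank_of_injective
        (f := (fderiv ℝ F p : (σ → ℝ) →ₗ[ℝ] τ → ℝ)) hinj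
    apply LinearMap.range_eq_top.2
    exact (LinearMap.injective_iff_surjective_of_finrank_eq_finrank
      (by simpa using le_antisymm hle hcard)).1 hinj
  exact hd.map_nhds_eq_of_surj hsurj

theorem aeval_injective {σ : Type*} {p : σ → ℝ} (hp : AlgebraicIndependent ℚ p) :
    Function.Injective (MvPolynomial.aeval p : MvPolynomial σ ℚ →ₐ[ℚ] ℝ) := hp

/-- A value algebraic over parameters is isolated among the roots of its relation, so near `p` it
cannot change while the parameters are kept fixed. -/
theorem eventually_eq_of_isAlgebraic {σ ι : Type*} [Finite σ] {p : σ → ℝ}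
    (hp : AlgebraicIndependent ℚ p) (y : ι → MvPolynomial σ ℚ) (z : MvPolynomial σ ℚ)
    (hz : IsAlgebraic (Algebra.adjoin ℚ (Set.range fun i => MvPolynomial.aeval p (y i)))
      (MvPolynomial.aeval p z)) :
    ∀ᶠ q in 𝓝 p, (∀ i, (MvPolynomial.aeval q (y i) : ℝ) = MvPolynomial.aeval p (y i)) →
      (MvPolynomial.aeval q z : ℝ) = MvPolynomial.aeval p z := by
  have := Fintype.ofFinite σ
  obtain ⟨P, hP0, hPsep⟩ := exists_separable_relation _ _ hz
  set w : ι → ℝ := fun i => MvPolynomial.aeval p (y i)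
  have hfin : Set.Finite ({t | (specialize P w).IsRoot t} \ {MvPolynomial.aeval p z}) :=
    (Polynomial.finite_setOfPred_isRoot hPsep.ne_zero).sdiff
  have hnear := (continuous_aeval z).continuousAt.eventually
    (hfin.isClosed.isOpen_compl.mem_nhds
      (fun h => h.2 rfl : MvPolynomial.aeval p z ∈ _))
  filter_upwards [hnear] with q hq hyq
  by_contra hne
  refine hq ⟨?_, hne⟩
  have h1 := specialize_eval_eq_zero hp y z P hP0 q
  rw [show (fun i => (MvPolynomial.aeval q (y i) : ℝ)) = w from funext hyq] at h1
  exact h1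

/-- A value transcendental over finitely many parameters can be changed by an arbitrarily small
motion of the generic point `p` that keeps the parameters fixed. -/
theorem exists_near_ne_of_transcendental {σ ι : Type*} [Finite σ] [Finite ι] {p : σ → ℝ}
    (hp : AlgebraicIndependent ℚ p) (y : ι → MvPolynomial σ ℚ) (z : MvPolynomial σ ℚ)
    (hz : Transcendental (Algebra.adjoin ℚ (Set.range fun i => MvPolynomial.aeval p (y i)))
      (MvPolynomial.aeval p z)) {U : Set (σ → ℝ)} (hU : U ∈ 𝓝 p) :
    ∃ q ∈ U, (∀ i, (MvPolynomial.aeval q (y i) : ℝ) = MvPolynomial.aeval p (y i)) ∧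
      (MvPolynomial.aeval q z : ℝ) ≠ MvPolynomial.aeval p z := by
  classical
  let v : MvPolynomial σ ℚ → ℝ := fun c => MvPolynomial.aeval p c
  -- a transcendence basis `b` of the parameters
  obtain ⟨b, hb⟩ := (AlgebraicIndependent.matroid ℚ ℝ).exists_isBasis
    (Set.range fun i => v (y i))
  have hb' := AlgebraicIndependent.matroid_isBasis_iff.1 hb
  have hzb : Transcendental (Algebra.adjoin ℚ b) (v z) := fun hcon =>
    hz ((AlgebraicIndependent.isAlgebraic_adjoin_iff_of_matroid_isBasis hb).1 hcon)
  -- extended by the new value and by coordinates to a transcendence basis of all coordinates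
  obtain ⟨t, ht, hbt⟩ := Matroid.Indep.subset_isBasis_of_subset
    (M := AlgebraicIndependent.matroid ℚ ℝ) (I := insert (v z) b)
    (X := insert (v z) b ∪ Set.range p)
    (AlgebraicIndependent.matroid_indep_iff.2 (AlgebraicIndepOn.insert hb'.1
      (by rwa [Set.image_id]))) Set.subset_union_left
  have ht' := AlgebraicIndependent.matroid_isBasis_iff.1 ht
  have hrange : t ⊆ Set.range v := by
    intro r hr
    rcases ht'.2.1 hr with (rfl | hr) | ⟨x, rfl⟩
    · exact ⟨z, rfl⟩
    · obtain ⟨i, rfl⟩ := hb'.2.1 hr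
      exact ⟨y i, rfl⟩
    · exact ⟨MvPolynomial.X x, by simp [v]⟩
  have htfin : Finite t := Set.Finite.subset
    ((((Set.finite_range _).subset hb'.2.1).insert _).union (Set.finite_range p)) ht'.2.1
  choose h hh using fun r : t => hrange r.2
  have hv : (fun i => v (h i)) = ((↑) : t → ℝ) := funext hh
  have hopen := map_nhds_eq_of_transcendenceBasis (τ := t) hp h
    (by
      change AlgebraicIndependent ℚ fun i => v (h i)
      rw [hv]
      exact ht'.1)
    (by
      intro x
      change IsAlgebraic (Algebra.adjoin ℚ (Set.range fun i => v (h i))) _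
      rw [hv, Subtype.range_coe]
      exact ht'.2.2 _ (Or.inr ⟨x, rfl⟩))
  have hzt : v z ∈ t := hbt (Set.mem_insert _ _)
  have hbt' : ∀ r : b, (r : ℝ) ∈ t := fun r => hbt (Set.mem_insert_of_mem _ r.2)
  -- near `p`, fixing the values in `b` fixes all the parameters
  have hfix : ∀ᶠ q in 𝓝 p, (∀ r : b, (MvPolynomial.aeval q (h ⟨r, hbt' r⟩) : ℝ) = r) →
      ∀ i, (MvPolynomial.aeval q (y i) : ℝ) = v (y i) := by
    have hbv : (fun r : b => v (h ⟨r, hbt' r⟩)) = ((↑) : b → ℝ) := funext fun r => hh _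
    have h1 : ∀ i, ∀ᶠ q in 𝓝 p, _ := fun i => eventually_eq_of_isAlgebraic hp
      (fun r : b => h ⟨r, hbt' r⟩) (y i) (by
        change IsAlgebraic (Algebra.adjoin ℚ (Set.range fun r : b => v (h ⟨r, hbt' r⟩))) (v (y i))
        rw [hbv, Subtype.range_coe]
        exact hb'.2.2 _ ⟨i, rfl⟩)
    filter_upwards [eventually_all.2 h1] with q hq hqb i
    exact hq i fun r => (hqb r).trans (hh ⟨r, hbt' r⟩).symm
  have himage := image_mem_map (m := fun (q : σ → ℝ) (i : t) =>
    (MvPolynomial.aeval q (h i) : ℝ)) (inter_mem hU hfix)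
  rw [hopen, show (fun i => (MvPolynomial.aeval p (h i) : ℝ)) = ((↑) : t → ℝ) from hv] at himage
  -- move only the value of `z`
  have hmove : Tendsto (fun s : ℝ => Function.update ((↑) : t → ℝ) ⟨v z, hzt⟩ s) (𝓝 (v z))
      (𝓝 ((↑) : t → ℝ)) := by
    have : Continuous fun s : ℝ => Function.update ((↑) : t → ℝ) ⟨v z, hzt⟩ s :=
      continuous_const.update _ continuous_id
    have h1 := this.tendsto (v z)
    rwa [Function.update_eq_self_iff.2 rfl] at h1
  obtain ⟨s, ⟨q, ⟨hqU, hqfix⟩, hqs⟩, hs⟩ := (((hmove.eventually himage).filter_mono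
    (nhdsWithin_le_nhds (s := {v z}ᶜ))).and self_mem_nhdsWithin).exists
  refine ⟨q, hqU, hqfix fun r => ?_, ?_⟩
  · refine (congrFun hqs ⟨r, hbt' r⟩).trans (Function.update_of_ne ?_ _ _)
    intro heq
    have hr : (r : ℝ) = v z := congrArg Subtype.val heq
    exact hzb (hr ▸ isAlgebraic_algebraMap
      (⟨r, Algebra.subset_adjoin r.2⟩ : Algebra.adjoin ℚ b))
  · have h1 := congrFun hqs ⟨v z, hzt⟩
    have h2 : h ⟨v z, hzt⟩ = z := aeval_injective hp (hh ⟨v z, hzt⟩)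
    simp only [Function.update_self, h2] at h1
    rw [h1]
    exact hs

/-! ### Coordinates of realizations -/

/-- The family of all vertex coordinates of a realization. -/
def coords {d : ℕ} {V : Type*} (p : Realization d V) : V × Fin d → ℝ := fun x => p x.1 x.2

/-- The realization with given vertex coordinates. -/
def ofCoords {d : ℕ} {V : Type*} (c : V × Fin d → ℝ) : Realization d V :=
  fun v => WithLp.toLp 2 fun i => c (v, i)

@[simp] theorem ofCoords_coords {d : ℕ} {V : Type*} (p : Realization d V) :
    ofCoords (coords p) = p := rfl

theorem continuous_ofCoords {d : ℕ} {V : Type*} :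
    Continuous (ofCoords : (V × Fin d → ℝ) → Realization d V) :=
  continuous_pi fun v => (PiLp.continuous_toLp 2 _).comp
    (continuous_pi fun i => continuous_apply (v, i))

theorem eventually_ofCoords_near {d : ℕ} {V : Type*} [Finite V] (p : Realization d V)
    {ε : ℝ} (hε : 0 < ε) : ∀ᶠ c in 𝓝 (coords p), ∀ v, ‖p v - ofCoords c v‖ < ε := by
  refine eventually_all.2 fun v => ?_
  have h : Continuous fun c : V × Fin d → ℝ => ‖p v - ofCoords c v‖ :=
    (continuous_const.sub ((continuous_apply v).comp continuous_ofCoords)).norm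
  exact h.continuousAt.eventually_lt_const (by simpa using hε)

/-- The squared distance of two vertices, as a polynomial in the coordinates. -/
noncomputable def sqDist (d : ℕ) {V : Type*} (u v : V) : MvPolynomial (V × Fin d) ℚ :=
  ∑ i, (MvPolynomial.X (u, i) - MvPolynomial.X (v, i)) ^ 2

theorem aeval_sqDist {d : ℕ} {V : Type*} (p : Realization d V) (u v : V) :
    (MvPolynomial.aeval (coords p) (sqDist d u v) : ℝ) = ‖p u - p v‖ ^ 2 := by
  simp [sqDist, EuclideanSpace.real_norm_sq_eq, coords]

/-- Generic realizations are dense, and a generic realization of an induced subgraph extends to a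
generic realization of the whole graph. -/
theorem exists_isGeneric_near {d : ℕ} {V : Type*} [Finite V] (X : Set V) (p : Realization d V)
    (hX : IsGeneric fun x : X => p x) {ε : ℝ} (hε : 0 < ε) :
    ∃ p' : Realization d V, IsGeneric p' ∧ (∀ x ∈ X, p' x = p x) ∧ ∀ v, ‖p v - p' v‖ < ε := by
  have := Fintype.ofFinite V
  obtain ⟨η, hη, hball⟩ := Metric.eventually_nhds_iff.1 (eventually_ofCoords_near p hε)
  obtain ⟨c, hcX, hcη, hc⟩ := exists_algebraicIndependent_near (Prod.fst ⁻¹' X) (coords p)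
    (hX.comp (fun x : (Prod.fst ⁻¹' X : Set (V × Fin d)) => ((⟨x.1.1, x.2⟩ : X), x.1.2))
      (fun x y h => by
        simp only [Prod.mk.injEq, Subtype.mk.injEq] at h
        exact Subtype.ext (Prod.ext h.1 h.2))) hη
  refine ⟨ofCoords c, hc, fun x hx => ?_, hball ((dist_pi_lt_iff hη).2 hcη)⟩
  ext i
  exact hcX (x, i) hx

theorem exists_isGeneric (d : ℕ) (V : Type*) [Finite V] : ∃ p : Realization d V, IsGeneric p := by
  obtain ⟨p, hp, -⟩ := exists_isGeneric_near (d := d) (∅ : Set V) 0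
    ((algebraicIndependent_empty_type_iff ..).2 (algebraMap ℚ ℝ).injective) one_pos
  exact ⟨p, hp⟩

theorem IsGeneric.injective {d : ℕ} (hd : 1 ≤ d) {V : Type*} {p : Realization d V}
    (hp : IsGeneric p) : Function.Injective p := by
  intro u v h
  have := AlgebraicIndependent.injective hp (a₁ := (u, ⟨0, hd⟩)) (a₂ := (v, ⟨0, hd⟩)) (by simp [h])
  exact congrArg Prod.fst this

/-! ### Rigid graphs -/

/-- In a rigid graph all distances of a generic realization are algebraic over the edge lengths:
a transcendental one could be changed continuously. -/
theorem IsRigid.isAlgebraic_sqDist {d : ℕ} {V : Type*} [Finite V] {G : SimpleGraph V}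
    (hG : IsRigid d G) {p : Realization d V} (hp : IsGeneric p) (u v : V) :
    IsAlgebraic (Algebra.adjoin ℚ (Set.range fun e : {e : V × V // G.Adj e.1 e.2} =>
      (MvPolynomial.aeval (coords p) (sqDist d e.1.1 e.1.2) : ℝ)))
      (MvPolynomial.aeval (coords p) (sqDist d u v) : ℝ) := by
  by_contra hcon
  obtain ⟨ε, hε, hrig⟩ := hG p hp
  obtain ⟨q, hqU, hq, hne⟩ := exists_near_ne_of_transcendental (p := coords p) hp
    (fun e : {e : V × V // G.Adj e.1 e.2} => sqDist d e.1.1 e.1.2) (sqDist d u v) hcon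
    (eventually_ofCoords_near p hε)
  have hq' : ∀ a b, (MvPolynomial.aeval q (sqDist d a b) : ℝ) =
      ‖ofCoords q a - ofCoords q b‖ ^ 2 := fun a b => aeval_sqDist (ofCoords q) a b
  refine hne ?_
  rw [hq', aeval_sqDist, hrig (ofCoords q) ?_ hqU u v]
  intro a b hab
  have h1 := hq ⟨(a, b), hab⟩
  rw [hq', aeval_sqDist] at h1
  exact (sq_eq_sq₀ (norm_nonneg _) (norm_nonneg _)).1 h1

/-- A rigid graph is connected, since otherwise one component could be translated. -/
theorem IsRigid.preconnected {d : ℕ} (hd : 1 ≤ d) {V : Type*} [Finite V] {G : SimpleGraph V}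
    (hG : IsRigid d G) : G.Preconnected := by
  classical
  intro a b
  by_contra hab
  obtain ⟨p, hp⟩ := exists_isGeneric d V
  obtain ⟨ε, hε, hrig⟩ := hG p hp
  have hne : p a - p b ≠ 0 := sub_ne_zero.2 fun h =>
    hab (hp.injective hd h ▸ SimpleGraph.Reachable.refl a)
  have hpos : 0 < ‖p a - p b‖ := norm_pos_iff.2 hne
  obtain ⟨τ, hτ, hτε⟩ : ∃ τ : ℝ, 0 < τ ∧ τ * ‖p a - p b‖ < ε :=
    ⟨ε / (2 * ‖p a - p b‖), by positivity, by field_simp; linarith⟩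
  let q : Realization d V := fun w => if G.Reachable a w then p w + τ • (p a - p b) else p w
  have hcong := hrig q (fun u v huv => by
    have hiff : G.Reachable a u ↔ G.Reachable a v :=
      ⟨fun h => h.trans huv.reachable, fun h => h.trans huv.symm.reachable⟩
    by_cases hv : G.Reachable a v
    · simp [q, hv, hiff.2 hv]
    · simp [q, hv, mt hiff.1 hv]) (fun v => by
    by_cases hv : G.Reachable a v
    · simpa [q, hv, norm_smul, abs_of_pos hτ] using hτε
    · simpa [q, hv] using hε)
  have h1 := hcong a b
  have h2 : q a - q b = (1 + τ) • (p a - p b) := by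
    simp only [q, hab, SimpleGraph.Reachable.refl, if_true, if_false]
    module
  rw [h2, norm_smul, Real.norm_eq_abs, abs_of_pos (by linarith)] at h1
  nlinarith

/-- Along a chain of relations, the distance of the ends is at most the number of steps times the
length of the longest one. -/
theorem exists_norm_le_of_reflTransGen {E V : Type*} [SeminormedAddCommGroup E] {R : V → V → Prop}
    {a b : V} (h : Relation.ReflTransGen R a b) :
    ∃ n : ℕ, ∀ (q : V → E) (M : ℝ), (∀ u v, R u v → ‖q u - q v‖ ≤ M) →
      ‖q a - q b‖ ≤ n * M := by
  induction h with
  | refl => exact ⟨0, by simp⟩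
  | @tail b c _ hbc ih =>
    obtain ⟨n, hn⟩ := ih
    refine ⟨n + 1, fun q M hM => ?_⟩
    have h1 := norm_sub_le_norm_sub_add_norm_sub (q a) (q b) (q c)
    push_cast
    linarith [hn q M hM, hM b c hbc]

theorem exists_norm_le_of_preconnected {E V : Type*} [SeminormedAddCommGroup E] [Finite V]
    {G : SimpleGraph V} (hG : G.Preconnected) (u : V) :
    ∃ n : ℕ, ∀ (q : V → E) (M : ℝ), 0 ≤ M → (∀ u v, G.Adj u v → ‖q u - q v‖ ≤ M) →
      ∀ w, ‖q w - q u‖ ≤ n * M := by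
  have := Fintype.ofFinite V
  choose n hn using fun w => exists_norm_le_of_reflTransGen (E := E)
    ((SimpleGraph.reachable_iff_reflTransGen w u).1 (hG w u))
  refine ⟨∑ w, n w, fun q M hM h w => (hn w q M h).trans ?_⟩
  gcongr
  exact Finset.single_le_sum (f := n) (fun _ _ => Nat.zero_le _) (Finset.mem_univ w)

/-! ### Realizations minimizing a distance -/

theorem continuous_specialize_eval {ι : Type*} (P : Polynomial (MvPolynomial ι ℚ)) :
    Continuous fun x : (ι → ℝ) × ℝ => (specialize P x.1).eval x.2 := by
  induction P using Polynomial.induction_on' with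
  | add P Q hP hQ => simpa [specialize, Pi.add_def] using hP.add hQ
  | monomial n a =>
    simpa [specialize, Pi.mul_def, Function.comp_def] using
      ((continuous_aeval a).comp continuous_fst).mul (continuous_snd.pow n)

theorem derivative_specialize {ι : Type*} (P : Polynomial (MvPolynomial ι ℚ)) (w : ι → ℝ) :
    (specialize P w).derivative = specialize P.derivative w :=
  Polynomial.derivative_map _ _

/-- The distance of `u` and `v` attains its minimum among the realizations equivalent to `p`. -/
theorem exists_equivalent_minimizing {d : ℕ} {V : Type*} [Finite V] {G : SimpleGraph V}
    (hG : G.Preconnected) (p : Realization d V) (u v : V) :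
    ∃ x : Realization d V, Equivalent G x p ∧
      ∀ q : Realization d V, Equivalent G q p → ‖x u - x v‖ ≤ ‖q u - q v‖ := by
  have := Fintype.ofFinite V
  obtain ⟨n, hn⟩ := exists_norm_le_of_preconnected (E := EuclideanSpace ℝ (Fin d)) hG u
  let S : Set (Realization d V) := {q | Equivalent G q p} ∩ {q | q u = 0}
  have hclosed : IsClosed S := by
    refine IsClosed.inter ?_ (isClosed_eq (continuous_apply u) continuous_const)
    simp only [Equivalent, Set.ofPred_forall]
    exact isClosed_iInter fun a => isClosed_iInter fun b => isClosed_iInter fun _ =>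
      isClosed_eq ((continuous_apply a).sub (continuous_apply b)).norm continuous_const
  have hbdd : S ⊆ Metric.closedBall 0 (n * (2 * ‖p‖)) := by
    rintro q ⟨hq, hu⟩
    rw [mem_closedBall_zero_iff, pi_norm_le_iff_of_nonneg (by positivity)]
    intro w
    have h1 := hn q (2 * ‖p‖) (by positivity) (fun a b hab => by
      rw [hq a b hab]
      linarith [norm_sub_le (p a) (p b), norm_le_pi_norm p a, norm_le_pi_norm p b]) w
    rwa [show q u = 0 from hu, sub_zero] at h1
  have hcompact : IsCompact S := (isCompact_closedBall _ _).of_isClosed_subset hclosed hbdd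
  have htrans : ∀ q : Realization d V, Equivalent G q p → (fun w => q w - q u) ∈ S :=
    fun q hq => ⟨fun a b hab => by simpa using hq a b hab, sub_self _⟩
  have hcont : Continuous fun q : Realization d V => ‖q u - q v‖ :=
    ((continuous_apply u).sub (continuous_apply v)).norm
  obtain ⟨x, hxS, hx⟩ := hcompact.exists_isMinOn ⟨_, htrans p fun _ _ _ => rfl⟩
    hcont.continuousOn
  exact ⟨x, hxS.1, fun q hq => by simpa using isMinOn_iff.1 hx _ (htrans q hq)⟩

/-- Two sequences of realizations that are pairwise equivalent, the second one convergent: the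
first one can be translated so as to have a convergent subsequence. -/
theorem exists_translated_subseq_tendsto {d : ℕ} {V : Type*} [Finite V] {G : SimpleGraph V}
    (hG : G.Preconnected) (u : V) {x : Realization d V} {p q : ℕ → Realization d V}
    (hp : Tendsto p atTop (𝓝 x)) (hq : ∀ n, Equivalent G (q n) (p n)) :
    ∃ (x' : Realization d V) (φ : ℕ → ℕ), StrictMono φ ∧
      Tendsto (fun n w => q (φ n) w - q (φ n) u) atTop (𝓝 x') := by
  have := Fintype.ofFinite V
  obtain ⟨N, hN⟩ := exists_norm_le_of_preconnected (E := EuclideanSpace ℝ (Fin d)) hG u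
  obtain ⟨C, hC⟩ := (Metric.isBounded_range_of_tendsto p hp).exists_norm_le
  have hC' : ∀ n, ‖p n‖ ≤ C := fun n => hC _ ⟨n, rfl⟩
  have hC0 : 0 ≤ C := (norm_nonneg _).trans (hC' 0)
  obtain ⟨x', -, φ, hφ, hlim⟩ := tendsto_subseq_of_bounded
    (Metric.isBounded_closedBall (x := (0 : Realization d V)) (r := N * (2 * C)))
    (x := fun n w => q n w - q n u) (fun n => by
      rw [mem_closedBall_zero_iff, pi_norm_le_iff_of_nonneg (by positivity)]
      refine hN (q n) (2 * C) (by positivity) fun a b hab => ?_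
      rw [hq n a b hab]
      linarith [norm_sub_le (p n a) (p n b), norm_le_pi_norm (p n) a, norm_le_pi_norm (p n) b,
        hC' n])
  exact ⟨x', φ, hφ, hlim⟩

/-- In a rigid graph there is a realization `x` near which the distance of `u` and `v` cannot be
decreased, nor slightly increased, by passing to an equivalent realization. One takes for `x` a
minimizer of that distance among the realizations equivalent to a generic one. The squared distance
is then a *simple* root of a polynomial with coefficients depending continuously on the edge
lengths, so that no second root can be close to it. -/
theorem IsRigid.exists_stable_minimum {d : ℕ} (hd : 1 ≤ d) {V : Type*} [Finite V]
    {G : SimpleGraph V} (hG : IsRigid d G) (u v : V) :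
    ∃ (x : Realization d V) (δ : ℝ), 0 < δ ∧
      ∀ p : Realization d V, (∀ w, ‖x w - p w‖ < δ) → ∀ q : Realization d V, Equivalent G q p →
        ‖q u - q v‖ < ‖p u - p v‖ + δ → ‖q u - q v‖ = ‖p u - p v‖ := by
  have := Fintype.ofFinite V
  have hconn := hG.preconnected hd
  obtain ⟨p₀, hp₀⟩ := exists_isGeneric d V
  let W : Realization d V → {e : V × V // G.Adj e.1 e.2} → ℝ :=
    fun q e => ‖q e.1.1 - q e.1.2‖ ^ 2
  have hW : ∀ q, W q = fun e => (MvPolynomial.aeval (coords q) (sqDist d e.1.1 e.1.2) : ℝ) :=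
    fun q => funext fun e => (aeval_sqDist q _ _).symm
  have hWcont : Continuous W := continuous_pi fun e =>
    ((continuous_apply e.1.1).sub (continuous_apply e.1.2)).norm.pow 2
  have hWeq : ∀ {q p}, Equivalent G q p → W q = W p := fun h =>
    funext fun e => congrArg (· ^ 2) (h _ _ e.2)
  let g : Realization d V → ℝ := fun q => ‖q u - q v‖
  have hgcont : Continuous g := ((continuous_apply u).sub (continuous_apply v)).norm
  obtain ⟨P, hP0, hPsep⟩ := exists_separable_relation _ _ (hG.isAlgebraic_sqDist hp₀ u v)
  have hP : ∀ q, (specialize P (W q)).eval (g q ^ 2) = 0 := fun q => by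
    have := specialize_eval_eq_zero hp₀ _ _ P hP0 (coords q)
    rwa [aeval_sqDist, ← hW] at this
  rw [← hW p₀] at hPsep
  obtain ⟨x, hxp, hxmin⟩ := exists_equivalent_minimizing hconn p₀ u v
  have hsimple : (specialize P.derivative (W x)).eval (g x ^ 2) ≠ 0 := by
    rw [← derivative_specialize]
    have hroot := hP x
    rw [hWeq hxp] at hroot ⊢
    simpa using hPsep.eval₂_derivative_ne_zero (RingHom.id ℝ) (by simpa using hroot)
  refine ⟨x, ?_⟩
  by_contra! hcon
  choose p hpx q hqp hlt hne using fun n : ℕ => hcon (1 / (n + 1 : ℝ)) (by positivity)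
  have hplim : Tendsto p atTop (𝓝 x) := by
    refine tendsto_pi_nhds.2 fun w => tendsto_iff_norm_sub_tendsto_zero.2 ?_
    refine squeeze_zero (fun _ => norm_nonneg _) (fun n => ?_)
      tendsto_one_div_add_atTop_nhds_zero_nat
    rw [norm_sub_rev]
    exact (hpx n w).le
  obtain ⟨x', φ, hφ, hqlim⟩ := exists_translated_subseq_tendsto hconn u hplim hqp
  have hpφ : Tendsto (fun n => p (φ n)) atTop (𝓝 x) := hplim.comp hφ.tendsto_atTop
  have hgp : Tendsto (fun n => g (p (φ n))) atTop (𝓝 (g x)) := (hgcont.tendsto x).comp hpφ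
  have hgq : Tendsto (fun n => g (q (φ n))) atTop (𝓝 (g x')) := by
    refine ((hgcont.tendsto x').comp hqlim).congr fun n => ?_
    simp [g]
  have hx'p : Equivalent G x' p₀ := by
    intro a b hab
    rw [← hxp a b hab]
    have hc : Continuous fun q : Realization d V => ‖q a - q b‖ :=
      ((continuous_apply a).sub (continuous_apply b)).norm
    refine tendsto_nhds_unique ((hc.tendsto x').comp hqlim)
      (((hc.tendsto x).comp hpφ).congr fun n => ?_)
    simpa using (hqp (φ n) a b hab).symm
  have hgx' : g x' = g x := by
    refine le_antisymm (le_of_tendsto_of_tendsto hgq (hgp.add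
      (tendsto_one_div_add_atTop_nhds_zero_nat.comp hφ.tendsto_atTop)) ?_ |>.trans_eq
        (add_zero _)) (hxmin x' hx'p)
    exact Eventually.of_forall fun n => (hlt (φ n)).le
  rw [hgx'] at hgq
  -- between the two distinct roots there is a critical point, which tends to the simple root
  have hrolle : ∀ n, ∃ c ∈ Set.uIcc (g (p n) ^ 2) (g (q n) ^ 2),
      (specialize P.derivative (W (p n))).eval c = 0 := by
    intro n
    have hroots : (specialize P (W (p n))).eval (g (p n) ^ 2) =
        (specialize P (W (p n))).eval (g (q n) ^ 2) := by
      rw [hP, ← hWeq (hqp n), hP]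
    have hne' : g (p n) ^ 2 ≠ g (q n) ^ 2 := fun h =>
      hne n ((sq_eq_sq₀ (norm_nonneg _) (norm_nonneg _)).1 h.symm)
    rw [← derivative_specialize]
    rcases lt_or_gt_of_ne hne' with h | h
    · obtain ⟨c, hc, hc0⟩ := exists_hasDerivAt_eq_zero h
        (specialize P (W (p n))).continuousOn hroots
        fun y _ => (specialize P (W (p n))).hasDerivAt y
      exact ⟨c, Set.Ioo_subset_Icc_self.trans Set.Icc_subset_uIcc hc, hc0⟩
    · obtain ⟨c, hc, hc0⟩ := exists_hasDerivAt_eq_zero h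
        (specialize P (W (p n))).continuousOn hroots.symm
        fun y _ => (specialize P (W (p n))).hasDerivAt y
      exact ⟨c, Set.Ioo_subset_Icc_self.trans Set.Icc_subset_uIcc' hc, hc0⟩
  choose c hc hc0 using hrolle
  have hclim : Tendsto (fun n => c (φ n)) atTop (𝓝 (g x ^ 2)) := by
    have h1 := (hgp.pow 2).min (hgq.pow 2)
    have h2 := (hgp.pow 2).max (hgq.pow 2)
    rw [min_self] at h1
    rw [max_self] at h2
    exact tendsto_of_tendsto_of_tendsto_of_le_of_le h1 h2 (fun n => (hc (φ n)).1)
      fun n => (hc (φ n)).2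
  refine hsimple (tendsto_nhds_unique
    (((continuous_specialize_eval P.derivative).tendsto (W x, g x ^ 2)).comp
      (((hWcont.tendsto x).comp hpφ).prodMk_nhds hclim)) ?_)
  exact tendsto_const_nhds.congr fun n => (hc0 (φ n)).symm

/-- If `u` and `v` lie in a rigid induced subgraph and are joined by a path outside of it, then
`{u, v}` is weakly globally linked. Collapsing the path onto `u` gives an upper bound for the
distance of `u` and `v`; near a minimizer of that distance this determines it. -/
theorem weaklyGloballyLinked_of_outer_path {d : ℕ} (hd : 1 ≤ d) {V : Type*} [Finite V]
    {G : SimpleGraph V} {X : Set V} (hX : IsRigid d (G.induce X)) {u v a b : V}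
    (hu : u ∈ X) (hv : v ∈ X) (hua : G.Adj u a) (hbv : G.Adj b v) (ha : a ∉ X) (hb : b ∉ X)
    (hab : Relation.ReflTransGen (fun s t => G.Adj s t ∧ s ∉ X ∧ t ∉ X) a b) :
    WeaklyGloballyLinked d G u v := by
  classical
  obtain ⟨x, δ, hδ, hx⟩ := hX.exists_stable_minimum hd ⟨u, hu⟩ ⟨v, hv⟩
  obtain ⟨n, hn⟩ := exists_norm_le_of_reflTransGen (E := EuclideanSpace ℝ (Fin d)) hab
  let ε : ℝ := δ / (4 * n + 5)
  have hε : 0 < ε := by positivity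
  have hεδ : ε * (4 * n + 5) = δ := div_mul_cancel₀ _ (by positivity)
  -- the vertices outside `X` are all placed at the position of `u`
  let x' : Realization d V := fun w => if h : w ∈ X then x ⟨w, h⟩ else x ⟨u, hu⟩
  obtain ⟨p, hp, -, hpx⟩ := exists_isGeneric_near (∅ : Set V) x'
    ((algebraicIndependent_empty_type_iff ..).2 (algebraMap ℚ ℝ).injective) hε
  refine ⟨p, hp, fun q hq => ?_⟩
  have hout : ∀ w, w ∉ X → ‖p u - p w‖ < 2 * ε := by
    intro w hw
    have h1 := hpx u
    have h2 := hpx w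
    simp only [x', hu, hw, dif_pos, dif_neg, not_false_eq_true] at h1 h2
    have h3 := norm_sub_le_norm_sub_add_norm_sub (p u) (x ⟨u, hu⟩) (p w)
    rw [norm_sub_rev] at h1
    linarith
  have hstep : ∀ s t, G.Adj s t ∧ s ∉ X ∧ t ∉ X → ‖q s - q t‖ ≤ 4 * ε := by
    rintro s t ⟨hst, hs, ht⟩
    rw [hq s t hst]
    have h3 := norm_sub_le_norm_sub_add_norm_sub (p s) (p u) (p t)
    have h1 := hout s hs
    rw [norm_sub_rev] at h1
    linarith [hout t ht]
  have hεle : ε ≤ δ := by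
    rw [← hεδ]
    nlinarith [(Nat.cast_nonneg n : (0 : ℝ) ≤ n)]
  have hpath : ‖q u - q v‖ < ‖p u - p v‖ + δ := by
    have h1 := norm_sub_le_norm_sub_add_norm_sub (q u) (q a) (q v)
    have h2 := norm_sub_le_norm_sub_add_norm_sub (q a) (q b) (q v)
    have h3 := norm_sub_le_norm_sub_add_norm_sub (p b) (p u) (p v)
    have h4 := hout b hb
    rw [norm_sub_rev] at h4
    rw [hq u a hua] at h1
    rw [hq b v hbv] at h2
    have h5 := hn q (4 * ε) hstep
    have h6 : (n : ℝ) * (4 * ε) + 4 * ε < δ := by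
      rw [← hεδ]
      linarith
    linarith [hout a ha]
  refine (hx (fun w => p w) (fun w => ?_) (fun w => q w)
    (fun s t hst => hq s t hst) hpath).symm
  have h1 := hpx w
  simp only [x', w.2, dif_pos] at h1
  exact h1.trans_le hεle

/-! ### Isometries and induced subgraphs -/

/-- Two finite families of vectors with the same norms and mutual distances differ by a linear
isometry, a product of reflections. -/
theorem exists_linearIsometryEquiv_map_eq {E κ : Type*} [NormedAddCommGroup E]
    [InnerProductSpace ℝ E] [FiniteDimensional ℝ E] (a b : κ → E)
    (hnorm : ∀ k, ‖a k‖ = ‖b k‖) (hdist : ∀ k l, ‖a k - a l‖ = ‖b k - b l‖) (S : Finset κ) :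
    ∃ L : E ≃ₗᵢ[ℝ] E, ∀ k ∈ S, L (a k) = b k := by
  classical
  have hinner : ∀ k l, inner ℝ (a k) (a l) = inner ℝ (b k) (b l) := by
    intro k l
    have h1 := norm_sub_sq_real (a k) (a l)
    have h2 := norm_sub_sq_real (b k) (b l)
    rw [hdist, hnorm, hnorm] at h1
    linarith
  induction S using Finset.induction_on with
  | empty => exact ⟨LinearIsometryEquiv.refl ℝ E, by simp⟩
  | @insert l S hl ih =>
    obtain ⟨L, hL⟩ := ih
    refine ⟨L.trans (Submodule.reflection (ℝ ∙ (L (a l) - b l))ᗮ), fun k hk => ?_⟩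
    rw [LinearIsometryEquiv.trans_apply]
    rcases Finset.mem_insert.1 hk with rfl | hk
    · exact Submodule.reflection_sub (by rw [L.norm_map, hnorm])
    · rw [hL k hk]
      refine Submodule.reflection_mem_subspace_eq_self ?_
      rw [Submodule.mem_orthogonal_singleton_iff_inner_right, inner_sub_left, ← hL k hk,
        L.inner_map_map, hL k hk, hinner, sub_self]

/-- The linear isometries of a finite-dimensional space form a compact set. -/
theorem exists_subseq_tendsto_linearIsometryEquiv {E : Type*} [NormedAddCommGroup E]
    [InnerProductSpace ℝ E] [FiniteDimensional ℝ E] (L : ℕ → E ≃ₗᵢ[ℝ] E) :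
    ∃ (L' : E ≃ₗᵢ[ℝ] E) (φ : ℕ → ℕ), StrictMono φ ∧
      ∀ z, Tendsto (fun n => L (φ n) z) atTop (𝓝 (L' z)) := by
  let T : ℕ → E →L[ℝ] E := fun n => (L n).toContinuousLinearEquiv
  obtain ⟨T', -, φ, hφ, hlim⟩ := tendsto_subseq_of_bounded
    (Metric.isBounded_closedBall (x := (0 : E →L[ℝ] E)) (r := 1)) (x := T) (fun n => by
      rw [mem_closedBall_zero_iff]
      exact ContinuousLinearMap.opNorm_le_bound _ zero_le_one fun z => by simp [T])
  have hz : ∀ z, Tendsto (fun n => L (φ n) z) atTop (𝓝 (T' z)) := fun z =>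
    ((ContinuousLinearMap.apply ℝ E z).continuous.tendsto T').comp hlim
  let I : E →ₗᵢ[ℝ] E := ⟨T'.toLinearMap, fun z => by
    have h1 := (hz z).norm
    simp only [LinearIsometryEquiv.norm_map] at h1
    exact tendsto_nhds_unique h1 tendsto_const_nhds⟩
  exact ⟨I.toLinearIsometryEquiv rfl, φ, hφ, hz⟩

/-- If a rigid graph is covered by the induced subgraphs on `A` and `B`, whose intersection is a
nonempty clique, then the one on `A` is rigid: a motion of it can be composed with small isometries
so as to fix the clique, and then extended to the whole graph. -/
theorem IsRigid.induce_of_clique_separator {d : ℕ} {V : Type*} [Finite V] {G : SimpleGraph V}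
    (hG : IsRigid d G) {A B : Set V} (hcover : ∀ s t, G.Adj s t → (s ∈ A ∧ t ∈ A) ∨ s ∈ B ∧ t ∈ B)
    (hclique : G.IsClique (A ∩ B)) (hne : (A ∩ B).Nonempty) : IsRigid d (G.induce A) := by
  classical
  obtain ⟨k₀, hk₀A, hk₀B⟩ := hne
  intro p₁ hp₁
  let p' : Realization d V := fun w => if h : w ∈ A then p₁ ⟨w, h⟩ else 0
  obtain ⟨p, hp, hpA, -⟩ := exists_isGeneric_near A p' (by simpa [p'] using hp₁) one_pos
  have hpp : ∀ w : A, p w = p₁ w := fun w => by simpa [p'] using hpA w w.2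
  obtain ⟨ε, hε, hrig⟩ := hG p hp
  by_contra hcon
  simp only [IsRigidFramework, not_exists, not_and, not_forall] at hcon
  choose q hqp hqn hqc using fun n : ℕ => hcon (1 / (n + 1 : ℝ)) (by positivity)
  have hqlim : ∀ w, Tendsto (fun n => q n w) atTop (𝓝 (p w)) := fun w => by
    refine tendsto_iff_norm_sub_tendsto_zero.2 ?_
    refine squeeze_zero (fun _ => norm_nonneg _) (fun n => ?_)
      tendsto_one_div_add_atTop_nhds_zero_nat
    rw [norm_sub_rev, hpp]
    exact (hqn n w).le
  have hdist : ∀ n, ∀ k l : (A ∩ B : Set V), ‖q n ⟨k, k.2.1⟩ - q n ⟨l, l.2.1⟩‖ = ‖p k - p l‖ := by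
    intro n k l
    by_cases hkl : k = l
    · simp [hkl]
    · have hadj : G.Adj k l := hclique k.2 l.2 (fun h => hkl (Subtype.ext h))
      rw [hqp n ⟨k, k.2.1⟩ ⟨l, l.2.1⟩ hadj, ← hpp, ← hpp]
  have := Fintype.ofFinite (A ∩ B : Set V)
  choose L hL using fun n => exists_linearIsometryEquiv_map_eq
    (fun k : (A ∩ B : Set V) => q n ⟨k, k.2.1⟩ - q n ⟨k₀, hk₀A⟩) (fun k => p k - p k₀)
    (fun k => hdist n k ⟨k₀, hk₀A, hk₀B⟩) (fun k l => by simpa using hdist n k l) Finset.univ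
  obtain ⟨L', φ, hφ, hlim⟩ := exists_subseq_tendsto_linearIsometryEquiv L
  -- `L (φ n)` moves the clique back to its place; correcting it by the inverse of its limit `L'`,
  -- which fixes the clique, makes it small
  let m : ℕ → A → EuclideanSpace ℝ (Fin d) := fun n w =>
    L'.symm (L (φ n) (q (φ n) w - q (φ n) ⟨k₀, hk₀A⟩)) + p k₀
  have hLlim : ∀ w : A, Tendsto (fun n => L (φ n) (q (φ n) w - q (φ n) ⟨k₀, hk₀A⟩)) atTop
      (𝓝 (L' (p w - p k₀))) := by
    intro w
    have h1 : Tendsto (fun n => q (φ n) w - q (φ n) ⟨k₀, hk₀A⟩) atTop (𝓝 (p w - p k₀)) :=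
      ((hqlim w).sub (hqlim ⟨k₀, hk₀A⟩)).comp hφ.tendsto_atTop
    have h2 : Tendsto (fun n => L (φ n) (q (φ n) w - q (φ n) ⟨k₀, hk₀A⟩) -
        L (φ n) (p w - p k₀)) atTop (𝓝 0) := by
      rw [tendsto_zero_iff_norm_tendsto_zero]
      simp only [← map_sub, LinearIsometryEquiv.norm_map]
      exact tendsto_iff_norm_sub_tendsto_zero.1 h1
    simpa using h2.add (hlim (p w - p k₀))
  have hmlim : ∀ w : A, Tendsto (fun n => m n w) atTop (𝓝 (p w)) := by
    intro w
    have h1 := ((L'.symm.continuous.tendsto _).comp (hLlim w)).add_const (p k₀)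
    simpa [m] using h1
  have hmfix : ∀ n, ∀ k : A, (k : V) ∈ B → m n k = p k := by
    intro n k hk
    have h1 : L' (p k - p k₀) = p k - p k₀ := by
      refine tendsto_nhds_unique (hLlim k) (tendsto_const_nhds.congr fun n => ?_)
      exact (hL (φ n) ⟨k, k.2, hk⟩ (Finset.mem_univ _)).symm
    have h2 := hL (φ n) ⟨k, k.2, hk⟩ (Finset.mem_univ _)
    simp only [m]
    rw [h2, ← h1, LinearIsometryEquiv.symm_apply_apply, sub_add_cancel]
  have hmdist : ∀ n, ∀ w z : A, ‖m n w - m n z‖ = ‖q (φ n) w - q (φ n) z‖ := by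
    intro n w z
    simp only [m, add_sub_add_right_eq_sub, ← map_sub, LinearIsometryEquiv.norm_map,
      sub_sub_sub_cancel_right]
  obtain ⟨n, hn⟩ : ∃ n, ∀ w : A, ‖p w - m n w‖ < ε := by
    refine (eventually_all.2 fun w : A => ?_).exists (f := atTop)
    have h1 := ((hmlim w).const_sub (p w)).norm
    rw [sub_self, norm_zero] at h1
    exact h1.eventually_lt_const hε
  let r : Realization d V := fun w => if h : w ∈ A then m n ⟨w, h⟩ else p w
  have hrA : ∀ w : A, r w = m n w := fun w => by simp [r]
  have hrB : ∀ w ∈ B, r w = p w := by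
    intro w hw
    by_cases h : w ∈ A
    · simpa [r, h] using hmfix n ⟨w, h⟩ hw
    · simp [r, h]
  refine hqc (φ n) fun s t => ?_
  rw [← hmdist, ← hrA, ← hrA, ← hpp, ← hpp]
  refine hrig r (fun s t hst => ?_) (fun w => ?_) s t
  · rcases hcover s t hst with ⟨hs, ht⟩ | ⟨hs, ht⟩
    · have h1 := hqp (φ n) ⟨s, hs⟩ ⟨t, ht⟩ hst
      rwa [← hmdist, ← hrA, ← hrA, ← hpp, ← hpp] at h1
    · rw [hrB s hs, hrB t ht]
  · by_cases h : w ∈ A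
    · simpa [r, h] using hn ⟨w, h⟩
    · simpa [r, h] using hε

/-- Total looseness passes to induced subgraphs. -/
theorem IsTotallyLoose.induce {d : ℕ} {V : Type*} [Finite V] {G : SimpleGraph V}
    (hG : IsTotallyLoose d G) (A : Set V) : IsTotallyLoose d (G.induce A) := by
  classical
  rintro u v huv hadj ⟨p₁, hp₁, hlink⟩
  let p' : Realization d V := fun w => if h : w ∈ A then p₁ ⟨w, h⟩ else 0
  obtain ⟨p, hp, hpA, -⟩ := exists_isGeneric_near A p' (by simpa [p'] using hp₁) one_pos
  have hpp : ∀ w : A, p w = p₁ w := fun w => by simpa [p'] using hpA w w.2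
  refine hG u v (fun h => huv (Subtype.ext h)) hadj ⟨p, hp, fun q hq => ?_⟩
  rw [hpp, hpp]
  refine hlink (fun w => q w) fun s t hst => ?_
  rw [← hpp, ← hpp]
  exact hq s t hst

/-! ### Clique sums -/

/-- A graph covered by two induced subgraphs that intersect in a clique is their clique sum. -/
theorem isCliqueSum_induce {V : Type*} [Finite V] {G : SimpleGraph V} {A B : Set V}
    (hAB : A ∪ B = Set.univ)
    (hcover : ∀ s t, G.Adj s t → (s ∈ A ∧ t ∈ A) ∨ s ∈ B ∧ t ∈ B)
    (hclique : G.IsClique (A ∩ B)) :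
    IsCliqueSum (A ∩ B).ncard (G.induce A) (G.induce B) G := by
  classical
  have := Fintype.ofFinite V
  let K₁ : Finset A := Finset.univ.filter fun x => (x : V) ∈ B
  let K₂ : Finset B := Finset.univ.filter fun x => (x : V) ∈ A
  let φ : K₁ ≃ K₂ :=
    { toFun := fun x => ⟨⟨x.1.1, (Finset.mem_filter.1 x.2).2⟩, by simp [K₂]⟩
      invFun := fun x => ⟨⟨x.1.1, (Finset.mem_filter.1 x.2).2⟩, by simp [K₁]⟩
      left_inv := fun _ => rfl
      right_inv := fun _ => rfl }
  have hK₁ : K₁.card = (A ∩ B).ncard := by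
    rw [← Set.ncard_coe_finset, ← Set.ncard_image_of_injective _ Subtype.val_injective]
    congr 1
    ext x
    simp [K₁, and_comm]
  have hK₂ : K₂.card = (A ∩ B).ncard := by
    rw [← hK₁]
    exact (Finset.card_eq_of_equiv φ).symm
  refine ⟨K₁, K₂, φ, Function.Embedding.subtype _, Function.Embedding.subtype _,
    ⟨?_, hK₁⟩, ⟨?_, hK₂⟩, ?_, by simpa using hAB, ?_⟩
  · intro x hx y hy hxy
    exact hclique ⟨x.2, (Finset.mem_filter.1 hx).2⟩ ⟨y.2, (Finset.mem_filter.1 hy).2⟩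
      fun h => hxy (Subtype.ext h)
  · intro x hx y hy hxy
    exact hclique ⟨(Finset.mem_filter.1 hx).2, x.2⟩ ⟨(Finset.mem_filter.1 hy).2, y.2⟩
      fun h => hxy (Subtype.ext h)
  · intro x y
    constructor
    · intro h
      have h' : (x : V) = y := h
      exact ⟨by simp [K₁, h'], Subtype.ext h'⟩
    · rintro ⟨hx, rfl⟩
      rfl
  · ext s t
    rw [SimpleGraph.sup_adj, SimpleGraph.map_adj, SimpleGraph.map_adj]
    constructor
    · intro h
      rcases hcover s t h with ⟨hs, ht⟩ | ⟨hs, ht⟩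
      · exact Or.inl ⟨⟨s, hs⟩, ⟨t, ht⟩, h, rfl, rfl⟩
      · exact Or.inr ⟨⟨s, hs⟩, ⟨t, ht⟩, h, rfl, rfl⟩
    · rintro (⟨s, t, h, rfl, rfl⟩ | ⟨s, t, h, rfl, rfl⟩)
      · exact h
      · exact h

end GraphRigidity

theorem mainTheorem8 (d : ℕ) (hd : 1 ≤ d) {V : Type u} [Finite V] (G : SimpleGraph V)
    (hrigid : GraphRigidity.IsRigid d G) (hloose : GraphRigidity.IsTotallyLoose d G) :
    GraphRigidity.ObtainedFromSpecial d G := by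
  open GraphRigidity in
  induction hN : Nat.card V using Nat.strong_induction_on generalizing V with
  | _ N ih =>
  subst hN
  by_cases hspecial : IsSpecial d G
  · exact .special G hspecial
  obtain ⟨X, hXuniv, hXrigid, hXtop⟩ : ∃ X : Set V, X ≠ Set.univ ∧ IsRigid d (G.induce X) ∧
      G.induce X ≠ ⊤ := by
    simpa [IsSpecial, hrigid] using hspecial
  obtain ⟨c, hc⟩ := (Set.ne_univ_iff_exists_notMem X).1 hXuniv
  -- the component of `c` outside `X`
  let R : V → V → Prop := fun s t => G.Adj s t ∧ s ∉ X ∧ t ∉ X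
  have : Std.Symm R := ⟨fun s t h => ⟨h.1.symm, h.2.2, h.2.1⟩⟩
  let C : Set V := {w | Relation.ReflTransGen R c w}
  have hCX : ∀ w ∈ C, w ∉ X := by
    intro w hw
    rcases Relation.ReflTransGen.cases_tail hw with rfl | ⟨_, _, h⟩
    · exact hc
    · exact h.2.2
  -- its neighbours lie in `X`
  let A : Set V := Cᶜ
  let B : Set V := C ∪ {w | ∃ s ∈ C, G.Adj s w}
  have hnbX : ∀ w ∈ A ∩ B, w ∈ X ∧ ∃ s ∈ C, G.Adj s w := by
    rintro w ⟨hwA, hwB | ⟨s, hs, hsw⟩⟩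
    · exact absurd hwB hwA
    · refine ⟨by_contra fun hwX => hwA ?_, s, hs, hsw⟩
      exact Relation.ReflTransGen.tail hs ⟨hsw, hCX s hs, hwX⟩
  have hAB : A ∪ B = Set.univ := by
    rw [← Set.union_assoc, Set.compl_union_self, Set.univ_union]
  have hcover : ∀ s t, G.Adj s t → (s ∈ A ∧ t ∈ A) ∨ s ∈ B ∧ t ∈ B := by
    intro s t hst
    by_cases hs : s ∈ C
    · exact Or.inr ⟨Or.inl hs, Or.inr ⟨s, hs, hst⟩⟩
    · by_cases ht : t ∈ C
      · exact Or.inr ⟨Or.inr ⟨t, ht, hst.symm⟩, Or.inl ht⟩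
      · exact Or.inl ⟨hs, ht⟩
  have hclique : G.IsClique (A ∩ B) := by
    intro u hu v hv huv
    obtain ⟨huX, a, ha, hau⟩ := hnbX u hu
    obtain ⟨hvX, b, hb, hbv⟩ := hnbX v hv
    by_contra hadj
    exact hloose u v huv hadj (weaklyGloballyLinked_of_outer_path hd hXrigid huX hvX hau.symm hbv
      (hCX a ha) (hCX b hb) ((Relation.ReflTransGen.stdSymm.symm _ _ ha).trans hb))
  -- two nonadjacent vertices of `X` show that both parts are proper
  obtain ⟨u, v, huv, hadj⟩ : ∃ u v : X, u ≠ v ∧ ¬ G.Adj u v := by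
    by_contra! hcon
    exact hXtop (by
      ext u v
      exact ⟨fun h => h.ne, fun h => hcon u v h⟩)
  have hXA : X ⊆ A := fun w hw hwC => hCX w hwC hw
  have hBuniv : B ≠ Set.univ := by
    intro h
    have hmem : ∀ w : X, (w : V) ∈ A ∩ B := fun w => ⟨hXA w.2, h ▸ Set.mem_univ _⟩
    exact hadj (hclique (hmem u) (hmem v) fun h => huv (Subtype.ext h))
  have hAuniv : A ≠ Set.univ := fun h =>
    (h ▸ Set.mem_univ c : c ∈ A) Relation.ReflTransGen.refl
  have hne : (A ∩ B).Nonempty := by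
    by_contra hempty
    have hstay : ∀ w, Relation.ReflTransGen G.Adj c w → w ∈ C := by
      intro w hw
      induction hw with
      | refl => exact Relation.ReflTransGen.refl
      | @tail s t _ hst ihs =>
        by_contra ht
        exact hempty ⟨t, ht, Or.inr ⟨s, ihs, hst⟩⟩
    exact hXA u.2 (hstay u ((SimpleGraph.reachable_iff_reflTransGen _ _).1
      (hrigid.preconnected hd c u)))
  have hlt : ∀ S : Set V, S ≠ Set.univ → Nat.card S < Nat.card V := by
    intro S hS
    rw [Nat.card_coe_set_eq, ← Set.ncard_univ]
    exact Set.ncard_lt_ncard (Set.ssubset_univ_iff.2 hS)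
  refine .cliqueSum (G.induce A) (G.induce B) G (A ∩ B).ncard
    ((Set.ncard_pos).2 hne) ?_ ?_ (isCliqueSum_induce hAB hcover hclique)
  · exact ih _ (hlt A hAuniv) (G.induce A)
      (hrigid.induce_of_clique_separator hcover hclique hne) (hloose.induce A) rfl
  · refine ih _ (hlt B hBuniv) (G.induce B) (hrigid.induce_of_clique_separator (B := A)
      (fun s t h => (hcover s t h).symm) ?_ ?_) (hloose.induce B) rfl
    · rwa [Set.inter_comm]
    · rwa [Set.inter_comm]
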